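/- Let $-2<\delta<-1$ and, for $0<q<1$, let $\tilde L_n^{(\delta)}(z;q)$ be the monic $q$-Laguerre polynomials, defined by $\tilde L_0^{(\delta)}(z;q)=1$, $\tilde L_1^{(\delta)}(z;q)=z-\frac{1-q^{\delta+1}}{q^{\delta+1}}$ and, for $m\ge 2$, $$\tilde L_m^{(\delta)}(z;q)=\left(z-\frac{1-q^m+q(1-q^{\delta+m-1})}{q^{\delta+2m-1}}\right)\tilde L_{m-1}^{(\delta)}(z;q)-\frac{(1-q^{m-1})(1-q^{\delta+m-1})}{q^{2\delta+4m-5}}\,\tilde L_{m-2}^{(\delta)}(z;q).$$ (For this range of $\delta$ they are quasi-orthogonal of order $1$ on $(0,\infty)$ with respect to $z^{\delta+1}/(-z;q)_\infty$.) Put $$A_n=\frac{(1-q^{\delta+1})(1-q^{\delta+2})}{q^{\delta+1}(1-q^{\delta+n+1})},\qquad B_n=\frac{(1-q^{\delta+1})(1-q^{\delta+3})}{q^{\delta+1}\left((1-q^n)+q(1-q^{\delta+n+1})\right)},\qquad c_n=-\frac{1-q^{\delta+1}}{q^{\delta+n+1}}.$$ Let $n\ge 2$. Then, for every $q\in(0,1)$,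 $\tilde L_n^{(\delta)}(z;q)$ has exactly one negative zero $z_{1,n}=z_{1,n}(q)$, this zero is simple, and $$-c_{n-1}<B_n<z_{1,n}<A_n<0.$$ Moreover, after division by $1-q$, these bounds become as $q\to1^-$ the Driver–Muldoon bounds for the Laguerre polynomial $L_n^{(\delta)}(x)=\sum_{k=0}^n(-1)^k\binom{n+\delta}{n-k}\frac{x^k}{k!}$: this polynomial has exactly one negative zero $x_{1,n}$, this zero is simple, $$\lim_{q\to1^-}\frac{z_{1,n}(q)}{1-q}=x_{1,n},\qquad \lim_{q\to1^-}\frac{-c_{n-1}}{1-q}=\delta+1,\qquad \lim_{q\to1^-}\frac{B_n}{1-q}=\frac{(\delta+1)(\delta+3)}{2n+\delta+1},\qquad \lim_{q\to1^-}\frac{A_n}{1-q}=\frac{(\delta+1)(\delta+2)}{\delta+n+1},$$ and $$\delta+1<\frac{(\delta+1)(\delta+3)}{2n+\delta+1}<x_{1,n}<\frac{(\delta+1)(\delta+2)}{\delta+n+1}<0.$$ -/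

import Mathlib

open Filter Topology Polynomial

noncomputable section

namespace QLaguerre

/-- The coefficient `a_m` of the three-term recurrence of the monic `q`-Laguerre polynomials. -/
def recA (δ q : ℝ) (m : ℕ) : ℝ :=
  (1 - q ^ m + q * (1 - q ^ (δ + m - 1))) / q ^ (δ + 2 * m - 1)

/-- The coefficient of the polynomial of degree `m - 2` in the three-term recurrence. -/
def recB (δ q : ℝ) (m : ℕ) : ℝ :=
  (1 - q ^ (m - 1)) * (1 - q ^ (δ + m - 1)) / q ^ (2 * δ + 4 * m - 5)

/-- The monic `q`-Laguerre polynomial of degree `n` with parameter `δ`, for any real `δ`,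
given by its three-term recurrence. -/
def qLaguerre (δ q : ℝ) : ℕ → ℝ[X]
  | 0 => 1
  | 1 => X - C ((1 - q ^ (δ + 1)) / q ^ (δ + 1))
  | n + 2 => (X - C (recA δ q (n + 2))) * qLaguerre δ q (n + 1)
      - C (recB δ q (n + 2)) * qLaguerre δ q n

/-- The classical Laguerre polynomial
`∑ k, (-1)^k * binom (n + α) (n - k) * x^k / k!`, with the generalized binomial coefficient
`binom (n + α) (n - k) = (α + k + 1) ⋯ (α + n) / (n - k)!`. -/
def laguerre (α : ℝ) (n : ℕ) : ℝ[X] :=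
  ∑ k ∈ Finset.range (n + 1),
    C ((-1) ^ k * ((∏ j ∈ Finset.Ioc k n, (α + j)) / (n - k).factorial) / k.factorial) * X ^ k

/-- The number `A_n`. -/
def boundA (δ q : ℝ) (n : ℕ) : ℝ :=
  (1 - q ^ (δ + 1)) * (1 - q ^ (δ + 2)) / (q ^ (δ + 1) * (1 - q ^ (δ + n + 1)))

/-- The number `B_n`. -/
def boundB (δ q : ℝ) (n : ℕ) : ℝ :=
  (1 - q ^ (δ + 1)) * (1 - q ^ (δ + 3)) /
    (q ^ (δ + 1) * ((1 - q ^ n) + q * (1 - q ^ (δ + n + 1))))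

/-- The number `c_n`. -/
def boundC (δ q : ℝ) (n : ℕ) : ℝ :=
  -((1 - q ^ (δ + 1)) / q ^ (δ + n + 1))

/-- `z` is a negative zero of `p`, it is simple, and `p` has no other negative zero. -/
def IsUniqueNegZero (p : ℝ[X]) (z : ℝ) : Prop :=
  p.rootMultiplicity z = 1 ∧ z < 0 ∧ ∀ x : ℝ, x < 0 → p.IsRoot x → x = z

end QLaguerre

end

/-! Put a = q^(δ+1) and y = -a z/(1-q). Up to a nonzero constant, the q-Laguerre polynomial becomes
p(y) = Σ_k [n over k] σ_0⋯σ_{k-1} t_k⋯t_{n-1} y^k, with q-binomials, σ_j = q^(2j) and t_j = (1 - a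
q^j)/(1-q) (`qLaguerre_eq`). The Laguerre polynomial has the same form with ordinary binomials, σ_j
= 1, t_j = δ+1+j and y = -x (`laguerre_eq`).

For -2 < δ < -1 only t_0 is negative, and it enters only the constant coefficient. Hence p is
strictly increasing on y ≥ 0, so a sign change there yields exactly one positive zero, which is
simple because p' > 0.

A_n corresponds to y_A = -t_0 t_1/t_n. There p is negative, because its coefficients are dominated
by those of (y - y_A) times a polynomial with positive coefficients (`eval_neg`). B_n corresponds to
a point where the quadratic truncation of p is already positive (`eval_pos`). Returning to z
reverses the order. The bound by -c_{n-1} is a direct computation.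

As q → 1 the coefficients converge, and monotonicity forces the zeros to converge. Strict
inequalities need not survive a limit, so the classical bounds are proved separately by the same two
tests. -/

noncomputable section

namespace QLaguerre

/-! ### Polynomials whose only negative coefficient is the constant one -/

/-- The factorial `ν 1 * ⋯ * ν d` built from a sequence of generalized numbers. -/
def numFac (ν : ℕ → ℝ) (d : ℕ) : ℝ := ∏ j ∈ Finset.range d, ν (j + 1)

/-- The coefficient of `X ^ k` in the generalized Laguerre polynomial of degree `k + d`. -/
def genCoeff (ν σ t : ℕ → ℝ) (k d : ℕ) : ℝ :=
  numFac ν (k + d) / (numFac ν k * numFac ν d) * (∏ j ∈ Finset.range k, σ j) *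
    ∏ j ∈ Finset.range d, t (k + j)

/-- A common form of the Laguerre and `q`-Laguerre polynomials, up to rescaling. -/
def genPoly (ν σ t : ℕ → ℝ) (n : ℕ) : ℝ[X] :=
  ∑ k ∈ Finset.range (n + 1), C (genCoeff ν σ t k (n - k)) * X ^ k

/-- Sign conditions under which only the constant coefficient of `genPoly` is negative. -/
structure Admissible (ν σ t : ℕ → ℝ) : Prop where
  num_pos : ∀ j, 0 < ν (j + 1)
  weight_pos : ∀ j, 0 < σ j
  zero_neg : t 0 < 0
  succ_pos : ∀ j, 0 < t (j + 1)

theorem numFac_succ (ν : ℕ → ℝ) (d : ℕ) : numFac ν (d + 1) = numFac ν d * ν (d + 1) := by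
  simp [numFac, Finset.prod_range_succ]

@[simp] theorem numFac_zero (ν : ℕ → ℝ) : numFac ν 0 = 1 := by simp [numFac]

theorem coeff_genPoly (ν σ t : ℕ → ℝ) (k d : ℕ) :
    (genPoly ν σ t (k + d)).coeff k = genCoeff ν σ t k d := by
  simp [genPoly, Polynomial.coeff_C_mul, Polynomial.coeff_X_pow]

theorem coeff_genPoly_of_lt (ν σ t : ℕ → ℝ) {n k : ℕ} (h : n < k) :
    (genPoly ν σ t n).coeff k = 0 := by
  simp only [genPoly, Polynomial.finsetSum_coeff, Polynomial.coeff_C_mul, Polynomial.coeff_X_pow]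
  refine Finset.sum_eq_zero fun j hj => ?_
  have := Finset.mem_range.1 hj
  rw [if_neg (by omega), mul_zero]

theorem eval_genPoly (ν σ t : ℕ → ℝ) (n : ℕ) (y : ℝ) :
    (genPoly ν σ t n).eval y = ∑ k ∈ Finset.range (n + 1), genCoeff ν σ t k (n - k) * y ^ k := by
  simp [genPoly, Polynomial.eval_finsetSum]

namespace Admissible

variable {ν σ t : ℕ → ℝ}

theorem numFac_pos (h : Admissible ν σ t) (d : ℕ) : 0 < numFac ν d :=
  Finset.prod_pos fun j _ => h.num_pos j

/-- The negative factor `t 0` occurs in the product of the `t (k + j)` only when `k = 0`. -/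
theorem genCoeff_pos (h : Admissible ν σ t) {k : ℕ} (hk : k ≠ 0) (d : ℕ) :
    0 < genCoeff ν σ t k d := by
  have h1 := h.numFac_pos k
  have h2 := h.numFac_pos d
  have h3 := h.numFac_pos (k + d)
  have h4 : 0 < ∏ j ∈ Finset.range k, σ j := Finset.prod_pos fun j _ => h.weight_pos j
  have h5 : 0 < ∏ j ∈ Finset.range d, t (k + j) := Finset.prod_pos fun j _ => by
    obtain ⟨i, rfl⟩ := Nat.exists_eq_succ_of_ne_zero hk
    rw [show i.succ + j = (i + j) + 1 by omega]
    exact h.succ_pos _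
  unfold genCoeff
  positivity

theorem strictMonoOn_eval (h : Admissible ν σ t) {n : ℕ} (hn : n ≠ 0) :
    StrictMonoOn (fun y => (genPoly ν σ t n).eval y) (Set.Ici 0) := by
  intro x hx y _ hxy
  simp only [eval_genPoly]
  refine Finset.sum_lt_sum (fun k _ => ?_)
    ⟨1, Finset.mem_range.2 (by omega), ?_⟩
  · rcases eq_or_ne k 0 with rfl | hk
    · simp
    · exact mul_le_mul_of_nonneg_left (pow_le_pow_left₀ hx hxy.le _) (h.genCoeff_pos hk _).le
  · simpa using mul_lt_mul_of_pos_left hxy (h.genCoeff_pos one_ne_zero _)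

theorem derivative_eval_pos (h : Admissible ν σ t) {n : ℕ} (hn : n ≠ 0) {y : ℝ} (hy : 0 < y) :
    0 < (derivative (genPoly ν σ t n)).eval y := by
  simp only [genPoly, derivative_sum, Polynomial.eval_finsetSum, derivative_C_mul, derivative_X_pow,
    eval_mul, eval_C, eval_pow, eval_X]
  refine Finset.sum_pos' (fun k _ => ?_) ⟨1, Finset.mem_range.2 (by omega), ?_⟩
  · rcases eq_or_ne k 0 with rfl | hk
    · simp
    · have := h.genCoeff_pos hk (n - k)
      positivity
  · simpa using h.genCoeff_pos one_ne_zero _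

/-! ### Sign tests and the resulting zero -/

/-- Negativity of `genPoly` at the zero of a linear factor, by a telescoping comparison. -/
theorem eval_neg (h : Admissible ν σ t) (N : ℕ) (hσ : σ 0 = 1)
    (hA : ∀ i d, i + d = N → ν (N + 2) * t (i + 1) * t (i + 2) <
      ν (i + 1) * t (i + 2) * t (N + 2) + t 0 * t 1 * σ (i + 1) * ν (d + 1)) :
    (genPoly ν σ t (N + 2)).eval (-(t 0 * t 1) / t (N + 2)) < 0 := by
  set y := -(t 0 * t 1) / t (N + 2) with hy
  have ht1 := h.succ_pos 0
  have htn := h.succ_pos (N + 1)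
  have hy0 : 0 < y := div_pos (by nlinarith [h.zero_neg]) htn
  -- Coefficients of the comparison factor, with `t` shifted by two. The product (X - y) Σ b_k X^k
  -- agrees with `genPoly` in the constant and leading coefficients and is strictly larger in all
  -- those between.
  set b : ℕ → ℝ := fun k => numFac ν (N + 1) / (numFac ν k * numFac ν (N + 1 - k)) *
    (∏ j ∈ Finset.range (k + 1), σ j) * ∏ j ∈ Finset.range (N + 1 - k), t (k + 2 + j) with hb
  have hbase : genCoeff ν σ t 0 (N + 2) = -(b 0 * y) := by
    have h1 := (h.numFac_pos (N + 1)).ne'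
    have h2 := (h.numFac_pos (N + 2)).ne'
    simp only [genCoeff, hb, hy, numFac_zero, zero_add, Finset.prod_range_zero, Finset.prod_range_one,
      hσ, tsub_zero]
    rw [Finset.prod_range_succ' _ (N + 1), Finset.prod_range_succ' _ N, Finset.prod_range_succ _ N]
    have e : ∀ j, t (j + 1 + 1) = t (2 + j) := fun j => by congr 1; omega
    simp only [e]
    rw [show 2 + N = N + 2 by omega]
    field_simp
  have hstep : ∀ i d, i + d = N →
      genCoeff ν σ t (i + 1) (d + 1) < b i - y * b (i + 1) := by
    rintro i d rfl
    have hT : 0 < ∏ j ∈ Finset.range d, t (i + 2 + j) := Finset.prod_pos fun j _ => by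
      rw [show i + 2 + j = (i + 1 + j) + 1 by omega]; exact h.succ_pos _
    set T := ∏ j ∈ Finset.range d, t (i + 2 + j) with hTdef
    have hS : 0 < ∏ j ∈ Finset.range (i + 1), σ j := Finset.prod_pos fun j _ => h.weight_pos j
    set S := ∏ j ∈ Finset.range (i + 1), σ j with hSdef
    have ht2 := h.succ_pos (i + 1)
    have hR : (∏ j ∈ Finset.range d, t (i + 1 + 2 + j)) * t (i + 2) = T * t (i + d + 2) := by
      have := Finset.prod_range_succ' (fun j => t (i + 2 + j)) d
      rw [Finset.prod_range_succ] at this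
      rw [show i + d + 2 = i + 2 + d by omega, hTdef, this]
      refine congrArg (· * t (i + 2)) (Finset.prod_congr rfl fun j _ => ?_)
      congr 1; omega
    have hR' : (∏ j ∈ Finset.range d, t (i + 1 + 2 + j)) = T * t (i + d + 2) / t (i + 2) := by
      rw [← hR]; field_simp
    have e1 : genCoeff ν σ t (i + 1) (d + 1) =
        numFac ν (i + d + 1) * ν (i + d + 2) /
          (numFac ν i * ν (i + 1) * (numFac ν d * ν (d + 1))) * S * (T * t (i + 1)) := by
      unfold genCoeff
      rw [show i + 1 + (d + 1) = (i + d + 1) + 1 by omega, numFac_succ ν (i + d + 1), numFac_succ ν i,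
        numFac_succ ν d, Finset.prod_range_succ' _ d]
      have e : ∀ j, t (i + 1 + (j + 1)) = t (i + 2 + j) := fun j => by congr 1; omega
      simp only [e, add_zero]
      rfl
    have e2 : b i = numFac ν (i + d + 1) / (numFac ν i * (numFac ν d * ν (d + 1))) * S *
        (T * t (i + d + 2)) := by
      simp only [hb]
      rw [show i + d + 1 - i = d + 1 by omega, numFac_succ ν d, Finset.prod_range_succ _ d,
        show i + 2 + d = i + d + 2 by omega]
    have e3 : b (i + 1) = numFac ν (i + d + 1) / (numFac ν i * ν (i + 1) * numFac ν d) *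
        (S * σ (i + 1)) * (T * t (i + d + 2) / t (i + 2)) := by
      simp only [hb]
      rw [show i + d + 1 - (i + 1) = d by omega, numFac_succ ν i, Finset.prod_range_succ _ (i + 1), hR']
    rw [e1, e2, e3, ← sub_pos, hy]
    have p1 := h.numFac_pos i
    have p2 := h.numFac_pos d
    have p3 := h.numFac_pos (i + d + 1)
    have p4 := h.num_pos i
    have p5 := h.num_pos d
    have key := hA i d rfl
    -- The difference of the two sides: a positive common factor times the gap in `hA`.
    have : 0 < numFac ν (i + d + 1) * S * T /
        (numFac ν i * numFac ν d * ν (i + 1) * ν (d + 1) * t (i + 2)) *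
        (ν (i + 1) * t (i + 2) * t (i + d + 2) + t 0 * t 1 * σ (i + 1) * ν (d + 1) -
          ν (i + d + 2) * t (i + 1) * t (i + 2)) := by
      have := sub_pos.2 key
      positivity
    convert this using 1
    field_simp
    ring
  -- Telescoping: the terms b_{k-1} y^k - b_k y^{k+1} leave only the last one, which the leading
  -- coefficient then cancels.
  have hpart : ∀ m, m ≤ N → ∑ k ∈ Finset.range (m + 2), genCoeff ν σ t k (N + 2 - k) * y ^ k <
      -(b (m + 1) * y ^ (m + 2)) := by
    intro m
    induction m with
    | zero =>
      intro _
      rw [Finset.sum_range_succ, Finset.sum_range_one, tsub_zero, hbase,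
        show N + 2 - 1 = N + 1 by omega]
      have := mul_lt_mul_of_pos_right (hstep 0 N (by omega)) hy0
      simp only [zero_add] at this ⊢
      nlinarith
    | succ m ih =>
      intro hm
      rw [Finset.sum_range_succ]
      have h1 := ih (by omega)
      have h2 := mul_lt_mul_of_pos_right (hstep (m + 1) (N - (m + 1)) (by omega))
        (pow_pos hy0 (m + 2))
      rw [show N - (m + 1) + 1 = N + 2 - (m + 2) by omega] at h2
      calc _ < -(b (m + 1) * y ^ (m + 2)) + (b (m + 1) - y * b (m + 1 + 1)) * y ^ (m + 2) :=
            add_lt_add h1 h2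
        _ = _ := by ring
  rw [eval_genPoly, Finset.sum_range_succ]
  have hlast : genCoeff ν σ t (N + 2) (N + 2 - (N + 2)) = b (N + 1) := by
    have h1 := (h.numFac_pos (N + 1)).ne'
    have h2 := (h.numFac_pos (N + 2)).ne'
    simp only [hb, genCoeff, Nat.sub_self, numFac_zero, Finset.prod_range_zero, add_zero, mul_one]
    rw [div_self h1, div_self h2]
  have := hpart N le_rfl
  rw [hlast]
  linarith

/-- Positivity of `genPoly` at a point where its quadratic truncation is positive. -/
theorem eval_pos (h : Admissible ν σ t) (N : ℕ) {y : ℝ} (hy : 0 < y)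
    (hB : 0 < t 0 * t 1 + ν (N + 2) / ν 1 * σ 0 * t 1 * y +
      ν (N + 2) * ν (N + 1) / (ν 1 * ν 2) * (σ 0 * σ 1) * y ^ 2) :
    0 < (genPoly ν σ t (N + 2)).eval y := by
  rw [eval_genPoly]
  have hle : ∑ k ∈ Finset.range 3, genCoeff ν σ t k (N + 2 - k) * y ^ k ≤
      ∑ k ∈ Finset.range (N + 2 + 1), genCoeff ν σ t k (N + 2 - k) * y ^ k := by
    refine Finset.sum_le_sum_of_subset_of_nonneg
      (Finset.range_subset_range.2 (by omega)) fun k _ hk => ?_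
    have hk0 : k ≠ 0 := by
      rintro rfl
      simp at hk
    have := h.genCoeff_pos hk0 (N + 2 - k)
    positivity
  refine lt_of_lt_of_le ?_ hle
  have hT : 0 < ∏ j ∈ Finset.range N, t (2 + j) := Finset.prod_pos fun j _ => by
    rw [show 2 + j = (1 + j) + 1 by omega]; exact h.succ_pos _
  have e : ∀ j, t (j + 1 + 1) = t (2 + j) := fun j => by congr 1; omega
  have e' : ∀ j, t (1 + (j + 1)) = t (2 + j) := fun j => by congr 1; omega
  have p1 := h.numFac_pos N
  have p2 := h.num_pos N
  have p3 := h.num_pos (N + 1)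
  have p4 := h.num_pos 0
  have p5 := h.num_pos 1
  -- The three lowest coefficients share the factor t_2⋯t_{N+1}; what remains is the quadratic in
  -- `hB`.
  have : 0 < (∏ j ∈ Finset.range N, t (2 + j)) * (t 0 * t 1 + ν (N + 2) / ν 1 * σ 0 * t 1 * y +
      ν (N + 2) * ν (N + 1) / (ν 1 * ν 2) * (σ 0 * σ 1) * y ^ 2) := mul_pos hT hB
  refine this.trans_eq ?_
  simp only [Finset.sum_range_succ, Finset.sum_range_zero, genCoeff, tsub_zero, zero_add,
    show N + 2 - 1 = N + 1 by omega, show N + 2 - 2 = N by omega, show 1 + (N + 1) = N + 1 + 1 by omega,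
    show 2 + N = N + 1 + 1 by omega, numFac_zero, Finset.prod_range_zero, Finset.prod_range_one,
    Finset.prod_range_succ' _ (N + 1), Finset.prod_range_succ' _ N, e, e']
  rw [show numFac ν 2 = ν 1 * ν 2 by simp [numFac, Finset.prod_range_succ],
    show numFac ν 1 = ν 1 by simp [numFac], numFac_succ ν (N + 1), numFac_succ ν N,
    show (∏ x ∈ Finset.range 2, σ x) = σ 0 * σ 1 by simp [Finset.prod_range_succ]]
  norm_num at p4 p5 ⊢
  field_simp

/-- The positive zero of `genPoly`, located between two points of opposite sign. -/
theorem exists_root (h : Admissible ν σ t) {n : ℕ} (hn : n ≠ 0) {yA yB : ℝ} (hA : 0 < yA)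
    (hB : 0 < yB) (hA' : (genPoly ν σ t n).eval yA < 0) (hB' : 0 < (genPoly ν σ t n).eval yB) :
    ∃ y, (genPoly ν σ t n).eval y = 0 ∧ yA < y ∧ y < yB := by
  have hAB : yA < yB :=
    ((h.strictMonoOn_eval hn).lt_iff_lt hA.le hB.le).1 (hA'.trans hB')
  obtain ⟨y, hy, hy0⟩ := intermediate_value_Ioo hAB.le
    (genPoly ν σ t n).continuous.continuousOn ⟨hA', hB'⟩
  exact ⟨y, hy0, hy.1, hy.2⟩

/-- The substitution by `r < 0` carries negative arguments to positive ones. Uniqueness comes from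
strict monotonicity, simplicity from the nonvanishing derivative. -/
theorem isUniqueNegZero (h : Admissible ν σ t) {n : ℕ} (hn : n ≠ 0) {y c r : ℝ} (hy : 0 < y)
    (hy0 : (genPoly ν σ t n).eval y = 0) (hc : c ≠ 0) (hr : r < 0) :
    IsUniqueNegZero (C c * (genPoly ν σ t n).comp (C r * X)) (y / r) := by
  have hry : r * (y / r) = y := mul_div_cancel₀ y hr.ne
  have hroot : (C c * (genPoly ν σ t n).comp (C r * X)).IsRoot (y / r) := by
    simp [Polynomial.IsRoot, Polynomial.eval_comp, hry, hy0]
  have hder : ¬ (derivative (C c * (genPoly ν σ t n).comp (C r * X))).IsRoot (y / r) := by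
    have := (h.derivative_eval_pos hn hy).ne'
    simp [Polynomial.IsRoot, Polynomial.derivative_comp, Polynomial.eval_comp, hry, hc, hr.ne, this]
  have hne : C c * (genPoly ν σ t n).comp (C r * X) ≠ 0 := by
    intro h0
    exact hder (by rw [h0]; simp)
  refine ⟨?_, div_neg_of_pos_of_neg hy hr, fun x hx hx0 => ?_⟩
  · have h1 : 0 < (C c * (genPoly ν σ t n).comp (C r * X)).rootMultiplicity (y / r) :=
      (Polynomial.rootMultiplicity_pos hne).2 hroot
    have h2 : ¬ 1 < (C c * (genPoly ν σ t n).comp (C r * X)).rootMultiplicity (y / r) := fun h3 =>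
      hder ((Polynomial.one_lt_rootMultiplicity_iff_isRoot hne).1 h3).2
    omega
  · have hx1 : (genPoly ν σ t n).eval (r * x) = 0 := by
      simpa [Polynomial.IsRoot, Polynomial.eval_comp, hc] using hx0
    have : r * x = y := (h.strictMonoOn_eval hn).injOn (mul_pos_of_neg_of_neg hr hx).le hy.le
      (hx1.trans hy0.symm)
    rw [← this, mul_div_cancel_left₀ x hr.ne]

end Admissible

/-! ### The explicit form of the q-Laguerre polynomials -/

/-- The `q`-number `[j]`. -/
def qNum (q : ℝ) (j : ℕ) : ℝ := (1 - q ^ j) / (1 - q)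

/-- The weight `q ^ (2 j)`. -/
def qWeight (q : ℝ) (j : ℕ) : ℝ := q ^ (2 * j)

/-- The factor `(1 - a q ^ j) / (1 - q)`. -/
def qShift (a q : ℝ) (j : ℕ) : ℝ := (1 - a * q ^ j) / (1 - q)

/-- The constant relating `qLaguerre` to `genPoly`. -/
def qScale (a q : ℝ) (n : ℕ) : ℝ := ∏ j ∈ Finset.range n, (-(1 - q) / (a * q ^ (2 * j)))

/-- The coefficient of `X ^ k` in the monic `q`-Laguerre polynomial of degree `k + d`. -/
def qCoeff (a q : ℝ) (k d : ℕ) : ℝ :=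
  qScale a q (k + d) * ((-a / (1 - q)) ^ k * genCoeff (qNum q) (qWeight q) (qShift a q) k d)

theorem coeff_comp_scale (P : ℝ[X]) (c r : ℝ) (k : ℕ) :
    (C c * P.comp (C r * X)).coeff k = c * (r ^ k * P.coeff k) := by
  rw [Polynomial.coeff_C_mul, Polynomial.comp_C_mul_X_coeff, mul_comm (r ^ k)]

section

variable {a q : ℝ}

theorem qNum_pos (hq : 0 < q) (hq' : q < 1) (j : ℕ) : 0 < qNum q (j + 1) :=
  div_pos (sub_pos.2 (pow_lt_one₀ hq.le hq' (by omega))) (sub_pos.2 hq')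

theorem numFac_qNum_ne_zero (hq : 0 < q) (hq' : q < 1) (d : ℕ) : numFac (qNum q) d ≠ 0 :=
  (Finset.prod_pos fun j _ => qNum_pos hq hq' j).ne'

theorem one_sub_pow_ne_zero (hq : 0 < q) (hq' : q < 1) (j : ℕ) : 1 - q ^ j * q ≠ 0 := by
  rw [← pow_succ]
  exact (sub_pos.2 (pow_lt_one₀ hq.le hq' (by omega))).ne'

theorem qScale_succ (n : ℕ) :
    qScale a q (n + 1) = qScale a q n * (-(1 - q) / (a * q ^ (2 * n))) := by
  rw [qScale, Finset.prod_range_succ, qScale]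

theorem qScale_ne_zero (ha : 0 < a) (hq : 0 < q) (hq' : q < 1) (n : ℕ) : qScale a q n ≠ 0 := by
  refine Finset.prod_ne_zero_iff.2 fun j _ => ?_
  have : 0 < 1 - q := sub_pos.2 hq'
  have : -(1 - q) ≠ 0 := by linarith
  positivity

theorem qCoeff_zero_right (ha : 0 < a) (hq : 0 < q) (hq' : q < 1) (n : ℕ) :
    qCoeff a q n 0 = 1 := by
  have h := numFac_qNum_ne_zero hq hq' n
  have h1 : 1 - q ≠ 0 := (sub_pos.2 hq').ne'
  have h2 : qScale a q n * ((-a / (1 - q)) ^ n * ∏ j ∈ Finset.range n, qWeight q j) = 1 := by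
    have hr : (-a / (1 - q)) ^ n = ∏ _j ∈ Finset.range n, (-a / (1 - q)) := by
      rw [Finset.prod_const, Finset.card_range]
    rw [qScale, hr, ← Finset.prod_mul_distrib, ← Finset.prod_mul_distrib]
    refine Finset.prod_eq_one fun j _ => ?_
    unfold qWeight
    field_simp
  simpa [qCoeff, genCoeff, div_self h] using h2

theorem qCoeff_one_right (ha : 0 < a) (hq : 0 < q) (hq' : q < 1) (n : ℕ) :
    qCoeff a q n 1 = -((1 - q ^ n * q) * (1 - a * q ^ n) / ((1 - q) * (a * q ^ (2 * n)))) := by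
  have h := numFac_qNum_ne_zero hq hq' n
  have h1 : 1 - q ≠ 0 := (sub_pos.2 hq').ne'
  have h0 := qCoeff_zero_right ha hq hq' n
  have : qCoeff a q n 1 = qCoeff a q n 0 *
      -((1 - q ^ n * q) * (1 - a * q ^ n) / ((1 - q) * (a * q ^ (2 * n)))) := by
    simp only [qCoeff, genCoeff, numFac_succ, qScale_succ, Finset.prod_range_one, add_zero,
      Finset.prod_range_zero, numFac_zero, zero_add]
    simp only [qShift, qNum, pow_succ, pow_zero, one_mul]
    field_simp
  rw [this, h0, one_mul]

theorem qCoeff_zero_left_recurrence (ha : 0 < a) (hq : 0 < q) (hq' : q < 1) (d : ℕ) :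
    qCoeff a q 0 (d + 2) =
      -((1 - q ^ (d + 2) + q * (1 - a * q ^ d)) / (a * q ^ (2 * d + 2))) * qCoeff a q 0 (d + 1) -
      (1 - q ^ (d + 1)) * (1 - a * q ^ d) / (a ^ 2 * q ^ (4 * d + 1)) * qCoeff a q 0 d := by
  have h1 : 1 - q ≠ 0 := (sub_pos.2 hq').ne'
  have f0 := numFac_qNum_ne_zero hq hq' d
  have f1 := numFac_qNum_ne_zero hq hq' (d + 1)
  have f2 := numFac_qNum_ne_zero hq hq' (d + 2)
  simp only [qCoeff, genCoeff, zero_add, numFac_zero, one_mul, div_self f0, div_self f1, div_self f2,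
    Finset.prod_range_zero, pow_zero, qScale_succ, Finset.prod_range_succ]
  generalize qScale a q d = s
  generalize ∏ j ∈ Finset.range d, qShift a q j = p
  simp only [qShift]
  field_simp
  ring

/-- The three-term recurrence read off at X^(i+1), for degree i+1+d+2. Neighbouring coefficients
differ by boundedly many factors, so it reduces to a rational identity in a, q, q^i and q^d. -/
theorem qCoeff_recurrence (ha : 0 < a) (hq : 0 < q) (hq' : q < 1) (i d : ℕ) :
    qCoeff a q (i + 1) (d + 2) = qCoeff a q i (d + 2) -
      (1 - q ^ (i + 1 + d + 2) + q * (1 - a * q ^ (i + 1 + d))) / (a * q ^ (2 * (i + 1 + d) + 2)) *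
        qCoeff a q (i + 1) (d + 1) -
      (1 - q ^ (i + 1 + d + 1)) * (1 - a * q ^ (i + 1 + d)) / (a ^ 2 * q ^ (4 * (i + 1 + d) + 1)) *
        qCoeff a q (i + 1) d := by
  have h1 : 1 - q ≠ 0 := (sub_pos.2 hq').ne'
  have f0 := numFac_qNum_ne_zero hq hq' d
  have f1 := numFac_qNum_ne_zero hq hq' i
  have n1 := one_sub_pow_ne_zero hq hq' i
  have n2 := one_sub_pow_ne_zero hq hq' d
  have n3 := one_sub_pow_ne_zero hq hq' (d + 1)
  have e : ∀ j, qShift a q (i + (j + 1)) = qShift a q (i + 1 + j) := fun j => by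
    congr 1; omega
  simp only [qCoeff, genCoeff, show i + 1 + (d + 2) = i + d + 1 + 1 + 1 by omega,
    show i + (d + 2) = i + d + 1 + 1 by omega, show i + 1 + (d + 1) = i + d + 1 + 1 by omega,
    show i + 1 + d = i + d + 1 by omega, numFac_succ, qScale_succ,
    Finset.prod_range_succ' (fun j => qShift a q (i + j)) (d + 1), e]
  simp only [Finset.prod_range_succ, show i + 1 + d = i + d + 1 by omega,
    show i + 1 + (d + 1) = i + d + 1 + 1 by omega]
  -- The long products common to all terms become opaque symbols.
  generalize qScale a q (i + d) = s
  generalize ∏ j ∈ Finset.range d, qShift a q (i + 1 + j) = p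
  generalize numFac (qNum q) (i + d) = f
  generalize numFac (qNum q) i = f' at *
  generalize numFac (qNum q) d = f'' at *
  generalize ∏ j ∈ Finset.range i, qWeight q j = w
  rw [pow_succ (-a / (1 - q)) i]
  generalize (-a / (1 - q)) ^ i = r
  have x1 : ∀ m, q ^ (2 * m) = q ^ m * q ^ m := fun m => by rw [two_mul, pow_add]
  have x2 : ∀ m, q ^ (4 * m) = q ^ m * q ^ m * q ^ m * q ^ m := fun m => by
    rw [show 4 * m = m + m + m + m by ring]; simp only [pow_add]
  simp only [qShift, qNum, qWeight, pow_succ, pow_zero, one_mul, pow_add, x1, x2, mul_add] at *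
  have hu : q ^ i ≠ 0 := by positivity
  have hv : q ^ d ≠ 0 := by positivity
  generalize q ^ i = u at *
  generalize q ^ d = v at *
  replace n1 : 1 - q * u ≠ 0 := by rwa [mul_comm]
  replace n2 : 1 - q * v ≠ 0 := by rwa [mul_comm]
  replace n3 : 1 - q ^ 2 * v ≠ 0 := by rwa [mul_comm, pow_two, ← mul_assoc]
  field_simp
  ring

end

theorem rpow_add_nat {q : ℝ} (hq : 0 < q) (s : ℝ) (m : ℕ) : q ^ (s + m) = q ^ s * q ^ m := by
  rw [Real.rpow_add hq, Real.rpow_natCast]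

theorem recA_add_two {δ q : ℝ} (hq : 0 < q) (n : ℕ) :
    recA δ q (n + 2) =
      (1 - q ^ (n + 2) + q * (1 - q ^ (δ + 1) * q ^ n)) / (q ^ (δ + 1) * q ^ (2 * n + 2)) := by
  rw [recA, ← rpow_add_nat hq, ← rpow_add_nat hq]
  congr 3 <;> push_cast <;> ring_nf

theorem recB_add_two {δ q : ℝ} (hq : 0 < q) (n : ℕ) :
    recB δ q (n + 2) =
      (1 - q ^ (n + 1)) * (1 - q ^ (δ + 1) * q ^ n) / ((q ^ (δ + 1)) ^ 2 * q ^ (4 * n + 1)) := by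
  have h : (q ^ (δ + 1)) ^ 2 = q ^ (2 * (δ + 1)) := by
    rw [← Real.rpow_mul_natCast hq.le]; push_cast; ring_nf
  rw [recB, h, ← rpow_add_nat hq, ← rpow_add_nat hq]
  congr 3 <;> push_cast <;> ring_nf

theorem coeff_scaled_genPoly {a q : ℝ} (k d : ℕ) :
    (C (qScale a q (k + d)) * (genPoly (qNum q) (qWeight q) (qShift a q) (k + d)).comp
      (C (-a / (1 - q)) * X)).coeff k = qCoeff a q k d := by
  rw [coeff_comp_scale, coeff_genPoly, qCoeff]

theorem coeff_scaled_genPoly_of_lt {a q : ℝ} {n k : ℕ} (h : n < k) :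
    (C (qScale a q n) * (genPoly (qNum q) (qWeight q) (qShift a q) n).comp
      (C (-a / (1 - q)) * X)).coeff k = 0 := by
  rw [coeff_comp_scale, coeff_genPoly_of_lt _ _ _ h, mul_zero, mul_zero]

theorem scaled_genPoly_recurrence {a q : ℝ} (ha : 0 < a) (hq : 0 < q) (hq' : q < 1) {P : ℕ → ℝ[X]}
    (hP : ∀ n, P n = C (qScale a q n) * (genPoly (qNum q) (qWeight q) (qShift a q) n).comp
      (C (-a / (1 - q)) * X)) (n : ℕ) :
    P (n + 2) = (X - C ((1 - q ^ (n + 2) + q * (1 - a * q ^ n)) / (a * q ^ (2 * n + 2)))) *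
        P (n + 1) -
      C ((1 - q ^ (n + 1)) * (1 - a * q ^ n) / (a ^ 2 * q ^ (4 * n + 1))) * P n := by
  have hc : ∀ k d, (P (k + d)).coeff k = qCoeff a q k d := fun k d => by
    rw [hP, coeff_scaled_genPoly]
  have hc0 : ∀ {n k}, n < k → (P n).coeff k = 0 := fun h => by
    rw [hP, coeff_scaled_genPoly_of_lt h]
  ext k
  rw [sub_mul, coeff_sub, coeff_sub, coeff_C_mul, coeff_C_mul]
  rcases k with _ | i
  · have h0 := hc 0 n
    have h1 := hc 0 (n + 1)
    have h2 := hc 0 (n + 2)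
    rw [zero_add] at h0 h1 h2
    rw [coeff_X_mul_zero, h0, h1, h2, qCoeff_zero_left_recurrence ha hq hq']
    ring
  rw [coeff_X_mul]
  -- `qCoeff` covers only exponents up to the degree. Exponents above n, namely the subleading, the
  -- leading and the vanishing coefficients, are treated apart.
  rcases Nat.lt_or_ge n (i + 1) with hlt | hge
  · rw [hc0 hlt]
    rcases Nat.lt_or_ge (n + 1) (i + 1) with hlt' | hge'
    · rw [hc0 hlt']
      rcases Nat.lt_or_ge (n + 2) (i + 1) with hlt2 | hge2
      · rw [hc0 hlt2, hc0 (by omega)]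
        ring
      · obtain rfl : i = n + 1 := by omega
        have h0 := hc (n + 2) 0
        have h1 := hc (n + 1) 0
        rw [add_zero, qCoeff_zero_right ha hq hq'] at h0 h1
        rw [show n + 1 + 1 = n + 2 from rfl, h0, h1]
        ring
    · obtain rfl : i = n := by omega
      have h0 := hc (i + 1) 0
      rw [add_zero, qCoeff_zero_right ha hq hq'] at h0
      rw [show i + 2 = i + 1 + 1 from rfl, h0, hc (i + 1) 1, hc i 1, qCoeff_one_right ha hq hq',
        qCoeff_one_right ha hq hq']
      have h1 : 1 - q ≠ 0 := (sub_pos.2 hq').ne'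
      field_simp
      ring
  · obtain ⟨d, rfl⟩ := Nat.exists_eq_add_of_le hge
    have h3 := hc i (d + 2)
    rw [show i + (d + 2) = i + 1 + d + 1 by omega] at h3
    rw [h3, hc (i + 1) d, show i + 1 + d + 1 = i + 1 + (d + 1) by omega, hc (i + 1) (d + 1),
      show i + 1 + d + 2 = i + 1 + (d + 2) by omega, hc (i + 1) (d + 2),
      qCoeff_recurrence ha hq hq']
    ring_nf

theorem qLaguerre_eq {δ q : ℝ} (hq : 0 < q) (hq' : q < 1) (n : ℕ) :
    qLaguerre δ q n = C (qScale (q ^ (δ + 1)) q n) *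
      (genPoly (qNum q) (qWeight q) (qShift (q ^ (δ + 1)) q) n).comp
        (C (-q ^ (δ + 1) / (1 - q)) * X) := by
  have ha : 0 < q ^ (δ + 1) := Real.rpow_pos_of_pos hq _
  have h1 : 1 - q ≠ 0 := (sub_pos.2 hq').ne'
  induction n using Nat.twoStepInduction with
  | zero => simp [qLaguerre, qScale, genPoly, genCoeff]
  | one =>
    ext k
    rcases k with _ | _ | k
    · have h := coeff_scaled_genPoly (a := q ^ (δ + 1)) (q := q) 0 1
      rw [zero_add, qCoeff_one_right ha hq hq'] at h
      rw [h]
      simp [qLaguerre]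
      field_simp
    · have h := coeff_scaled_genPoly (a := q ^ (δ + 1)) (q := q) 1 0
      rw [add_zero, qCoeff_zero_right ha hq hq'] at h
      rw [h]
      simp [qLaguerre]
    · rw [coeff_scaled_genPoly_of_lt (by omega)]
      simp [qLaguerre, coeff_X]
  | more n h0 h1 =>
    rw [scaled_genPoly_recurrence ha hq hq' (fun _ => rfl), qLaguerre, h0, h1, recA_add_two hq,
      recB_add_two hq]

/-! ### The explicit form of the Laguerre polynomials -/

theorem numFac_natCast (d : ℕ) : numFac (fun j => (j : ℝ)) d = d.factorial := by
  induction d with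
  | zero => simp
  | succ d ih => rw [numFac_succ, ih, Nat.factorial_succ]; push_cast; ring

theorem laguerre_eq (δ : ℝ) (n : ℕ) :
    laguerre δ n = C (1 / (n.factorial : ℝ)) *
      (genPoly (fun j => (j : ℝ)) (fun _ => 1) (fun j => δ + 1 + j) n).comp (C (-1) * X) := by
  have hn : (n.factorial : ℝ) ≠ 0 := by positivity
  simp only [genPoly, laguerre, Polynomial.sum_comp, Finset.mul_sum]
  refine Finset.sum_congr rfl fun k hk => ?_
  have hkn : k ≤ n := Nat.lt_succ_iff.1 (Finset.mem_range.1 hk)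
  have hprod : ∏ j ∈ Finset.Ioc k n, (δ + j) =
      ∏ j ∈ Finset.range (n - k), (δ + 1 + ((k + j : ℕ) : ℝ)) := by
    rw [← Finset.Ico_add_one_add_one_eq_Ioc, Finset.prod_Ico_eq_prod_range]
    rw [Nat.add_sub_add_right]
    refine Finset.prod_congr rfl fun j _ => ?_
    push_cast
    ring
  rw [mul_comp, C_comp, X_pow_comp, mul_pow, ← C_pow, ← mul_assoc, ← mul_assoc, ← C_mul, ← C_mul]
  congr 2
  rw [genCoeff, numFac_natCast, numFac_natCast, numFac_natCast, Nat.add_sub_cancel' hkn, hprod,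
    Finset.prod_const_one]
  field_simp

/-! ### Limits as q → 1 -/

/-- The quotient is the slope of x ↦ x^s between q and 1, so its limit is the derivative at 1. -/
theorem tendsto_one_sub_rpow_div (s : ℝ) :
    Tendsto (fun q : ℝ => (1 - q ^ s) / (1 - q)) (𝓝[<] 1) (𝓝 s) := by
  have h := (Real.hasDerivAt_rpow_const (x := 1) (p := s) (Or.inl one_ne_zero)).tendsto_slope
  rw [Real.one_rpow, mul_one] at h
  refine (h.mono_left (nhdsWithin_mono _ fun x hx => ne_of_lt hx)).congr' ?_
  filter_upwards [self_mem_nhdsWithin] with q _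
  rw [slope_def_field, Real.one_rpow, ← neg_sub 1, ← neg_sub 1 q, neg_div_neg_eq]

theorem tendsto_qNum (j : ℕ) : Tendsto (fun q => qNum q j) (𝓝[<] 1) (𝓝 j) := by
  simpa only [Real.rpow_natCast, qNum] using tendsto_one_sub_rpow_div j

theorem eventually_mem_unit : ∀ᶠ q : ℝ in 𝓝[<] 1, 0 < q ∧ q < 1 :=
  Ioo_mem_nhdsLT zero_lt_one

theorem tendsto_qShift (δ : ℝ) (j : ℕ) :
    Tendsto (fun q => qShift (q ^ (δ + 1)) q j) (𝓝[<] 1) (𝓝 (δ + 1 + j)) := by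
  refine (tendsto_one_sub_rpow_div (δ + 1 + j)).congr' ?_
  filter_upwards [eventually_mem_unit] with q hq
  rw [rpow_add_nat hq.1, qShift]

theorem tendsto_id_one : Tendsto (fun q : ℝ => q) (𝓝[<] 1) (𝓝 1) := nhdsWithin_le_nhds

theorem tendsto_rpow_one (s : ℝ) : Tendsto (fun q : ℝ => q ^ s) (𝓝[<] 1) (𝓝 1) := by
  simpa using tendsto_id_one.rpow_const (p := s) (Or.inl one_ne_zero)

theorem tendsto_qWeight (j : ℕ) : Tendsto (fun q => qWeight q j) (𝓝[<] 1) (𝓝 1) := by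
  simpa [qWeight] using tendsto_id_one.pow (2 * j)

theorem tendsto_numFac (d : ℕ) :
    Tendsto (fun q => numFac (qNum q) d) (𝓝[<] 1) (𝓝 (numFac (fun j => (j : ℝ)) d)) :=
  tendsto_finsetProd _ fun j _ => tendsto_qNum (j + 1)

theorem tendsto_eval_genPoly (δ : ℝ) (n : ℕ) (y : ℝ) :
    Tendsto (fun q => (genPoly (qNum q) (qWeight q) (qShift (q ^ (δ + 1)) q) n).eval y) (𝓝[<] 1)
      (𝓝 ((genPoly (fun j => (j : ℝ)) (fun _ => 1) (fun j => δ + 1 + j) n).eval y)) := by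
  simp only [eval_genPoly]
  refine tendsto_finsetSum _ fun k _ => Tendsto.mul_const _ ?_
  refine Tendsto.mul (Tendsto.mul (Tendsto.div (tendsto_numFac _)
    ((tendsto_numFac _).mul (tendsto_numFac _)) ?_) ?_) ?_
  · rw [numFac_natCast, numFac_natCast]
    positivity
  · exact tendsto_finsetProd _ fun j _ => tendsto_qWeight j
  · exact tendsto_finsetProd _ fun j _ => tendsto_qShift δ (k + j)

/-! ### Location of the zeros for the two families -/

theorem admissible_q {a q : ℝ} (hq : 0 < q) (hq' : q < 1) (ha : 1 < a) (haq : a * q < 1) :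
    Admissible (qNum q) (qWeight q) (qShift a q) where
  num_pos := qNum_pos hq hq'
  weight_pos j := pow_pos hq _
  zero_neg := div_neg_of_neg_of_pos (by simpa using ha) (sub_pos.2 hq')
  succ_pos j := by
    refine div_pos (sub_pos.2 ?_) (sub_pos.2 hq')
    calc a * q ^ (j + 1) = a * q * q ^ j := by ring
      _ ≤ a * q := mul_le_of_le_one_right (by positivity) (pow_le_one₀ hq.le hq'.le)
      _ < 1 := haq

theorem admissible_classical {δ : ℝ} (hδ : -2 < δ) (hδ' : δ < -1) :
    Admissible (fun j => (j : ℝ)) (fun _ => 1) (fun j => δ + 1 + j) where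
  num_pos j := by positivity
  weight_pos _ := one_pos
  zero_neg := by norm_num; linarith
  succ_pos j := by
    push_cast
    have : (0 : ℝ) ≤ j := j.cast_nonneg
    linarith

/-- Location of the positive zero of the rescaled `q`-Laguerre polynomial. -/
theorem exists_root_q {a q : ℝ} (hq : 0 < q) (hq' : q < 1) (ha : 1 < a) (haq : a * q < 1) (N : ℕ) :
    ∃ y, 0 < y ∧ (genPoly (qNum q) (qWeight q) (qShift a q) (N + 2)).eval y = 0 ∧
      -(qShift a q 0 * qShift a q 1) / qShift a q (N + 2) < y ∧
      y < -(qShift a q 0 * qShift a q 2) / (qNum q (N + 2) + q * qShift a q (N + 2)) := by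
  have h := admissible_q hq hq' ha haq
  have t0 := h.zero_neg
  have t1 : 0 < qShift a q 1 := h.succ_pos 0
  have t2 : 0 < qShift a q 2 := h.succ_pos 1
  have tn : 0 < qShift a q (N + 2) := h.succ_pos (N + 1)
  have νn : 0 < qNum q (N + 2) := h.num_pos (N + 1)
  have hD : 0 < qNum q (N + 2) + q * qShift a q (N + 2) := by positivity
  have hyA : 0 < -(qShift a q 0 * qShift a q 1) / qShift a q (N + 2) :=
    div_pos (by nlinarith) tn
  have hyB : 0 < -(qShift a q 0 * qShift a q 2) / (qNum q (N + 2) + q * qShift a q (N + 2)) :=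
    div_pos (by nlinarith) hD
  have h1 : 0 < 1 - q := sub_pos.2 hq'
  -- The two conjuncts are the sign conditions at the endpoints, found by unification.
  suffices hs : _ ∧ _ by
    obtain ⟨y, hy0, hA, hB⟩ := h.exists_root (Nat.succ_ne_zero (N + 1)) hyA hyB hs.1 hs.2
    exact ⟨y, hyA.trans hA, hy0, hA, hB⟩
  refine ⟨h.eval_neg N (by simp [qWeight]) ?_, h.eval_pos N hyB ?_⟩
  · rintro i d rfl
    have hu : 0 < 1 - q ^ (i + 1) := sub_pos.2 (pow_lt_one₀ hq.le hq' (by omega))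
    have hv : 0 < 1 - q ^ (d + 1) := sub_pos.2 (pow_lt_one₀ hq.le hq' (by omega))
    have hu' : 0 < q ^ (i + 1) := by positivity
    have ha' : 0 < a - 1 := sub_pos.2 ha
    rw [← sub_pos]
    -- The exact gap between the two sides of the coefficient inequality.
    have : 0 < (a - 1) * (1 - q ^ (i + 1)) * q ^ (i + 1) * (1 - q ^ (d + 1)) / (1 - q) ^ 3 := by
      positivity
    refine this.trans_eq ?_
    simp only [qNum, qShift, qWeight, show i + d + 2 = (i + 1) + (d + 1) by omega,
      show i + 2 = (i + 1) + 1 by omega, pow_add q (i + 1), pow_zero, pow_one, two_mul]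
    generalize q ^ (i + 1) = u
    generalize q ^ (d + 1) = v
    field_simp
    ring
  · have hw : 0 ≤ 1 - q ^ N := sub_nonneg.2 (pow_le_one₀ hq.le hq'.le)
    have hw' : 0 < 1 - q ^ N * q := by
      rw [← pow_succ]; exact sub_pos.2 (pow_lt_one₀ hq.le hq' (by omega))
    have ha' : 0 < a - 1 := sub_pos.2 ha
    have h2 : 0 < 1 - q ^ 2 := sub_pos.2 (pow_lt_one₀ hq.le hq' (by omega))
    have hD' : qNum q (N + 2) + q * qShift a q (N + 2) =
        ((1 - q ^ N * q ^ 2) + q * (1 - a * (q ^ N * q ^ 2))) / (1 - q) := by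
      simp only [qNum, qShift, pow_add]
      ring
    have hE : 0 < (1 - q ^ N * q ^ 2) + q * (1 - a * (q ^ N * q ^ 2)) := by
      rw [hD'] at hD
      exact (div_pos_iff_of_pos_right h1).1 hD
    -- The exact value of the quadratic truncation at the chosen point. For N = 0 the second factor
    -- is positive through its first summand.
    have : 0 < (a - 1) ^ 3 * q ^ 3 * (1 - q ^ N * q) *
        ((1 - q) * (1 - q ^ 2) + q ^ 3 * (a - 1) * (1 - q ^ N)) /
        ((1 - q) ^ 3 * (1 - q ^ 2) *
          ((1 - q ^ N * q ^ 2) + q * (1 - a * (q ^ N * q ^ 2))) ^ 2) := by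
      positivity
    refine this.trans_eq ?_
    rw [hD']
    simp only [qNum, qShift, qWeight, pow_add, mul_zero, mul_one, pow_zero, pow_one]
    generalize q ^ N = w at *
    generalize hEe : (1 - w * q ^ 2) + q * (1 - a * (w * q ^ 2)) = E at *
    field_simp
    rw [← hEe]
    ring

/-- Location of the positive zero of the reflected Laguerre polynomial. -/
theorem exists_root_classical {δ : ℝ} (hδ : -2 < δ) (hδ' : δ < -1) (N : ℕ) :
    ∃ y, 0 < y ∧
      (genPoly (fun j => (j : ℝ)) (fun _ => 1) (fun j => δ + 1 + j) (N + 2)).eval y = 0 ∧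
      -((δ + 1) * (δ + 2)) / (δ + (N + 2 : ℕ) + 1) < y ∧
      y < -((δ + 1) * (δ + 3)) / (2 * (N + 2 : ℕ) + δ + 1) := by
  have h := admissible_classical hδ hδ'
  have hN : (0 : ℝ) ≤ N := N.cast_nonneg
  have hD : 0 < 2 * ((N + 2 : ℕ) : ℝ) + δ + 1 := by push_cast; linarith
  have hyA : 0 < -((δ + 1) * (δ + 2)) / (δ + (N + 2 : ℕ) + 1) :=
    div_pos (by nlinarith) (by push_cast; linarith)
  have hyB : 0 < -((δ + 1) * (δ + 3)) / (2 * (N + 2 : ℕ) + δ + 1) :=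
    div_pos (by nlinarith) hD
  suffices hs : _ ∧ _ by
    obtain ⟨y, hy0, hA, hB⟩ := h.exists_root (Nat.succ_ne_zero (N + 1)) hyA hyB hs.1 hs.2
    exact ⟨y, hyA.trans hA, hy0, hA, hB⟩
  refine ⟨?_, h.eval_pos N hyB ?_⟩
  · convert h.eval_neg N rfl ?_ using 2
    · push_cast
      congr 1 <;> ring
    · rintro i d rfl
      rw [← sub_pos]
      -- The q → 1 limit of the gap in the q-case, where (a-1)/(1-q) tends to -(δ+1); the value of
      -- the quadratic below is likewise such a limit.
      have : 0 < -(δ + 1) * (i + 1) * ((d : ℝ) + 1) :=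
        mul_pos (mul_pos (by linarith) (by positivity)) (by positivity)
      refine this.trans_eq ?_
      push_cast
      ring
  · have : 0 < (-(δ + 1)) ^ 3 * (N + 1) * (1 + N * -(δ + 1) / 2) /
        (2 * ((N + 2 : ℕ) : ℝ) + δ + 1) ^ 2 := by
      have : 0 < -(δ + 1) := by linarith
      positivity
    refine this.trans_eq ?_
    push_cast at hD ⊢
    field_simp
    ring

/-! ### The bounds in the original variable and their limits -/

theorem boundA_eq {δ q : ℝ} (hq : 0 < q) (hq' : q < 1) (n : ℕ) :
    boundA δ q n = -(qShift (q ^ (δ + 1)) q 0 * qShift (q ^ (δ + 1)) q 1) /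
      qShift (q ^ (δ + 1)) q n / (-q ^ (δ + 1) / (1 - q)) := by
  have h1 : 1 - q ≠ 0 := (sub_pos.2 hq').ne'
  have ha : 0 < q ^ (δ + 1) := Real.rpow_pos_of_pos hq _
  have e1 : q ^ (δ + 2) = q ^ (δ + 1) * q := by
    rw [← Real.rpow_add_one hq.ne']; ring_nf
  have e2 : q ^ (δ + n + 1) = q ^ (δ + 1) * q ^ n := by
    rw [← rpow_add_nat hq]; ring_nf
  rw [boundA, e1, e2]
  simp only [qShift, pow_zero, pow_one, mul_one]
  generalize 1 - q ^ (δ + 1) * q ^ n = s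
  -- The denominator may vanish for general δ; both sides are then 0 by the convention on division.
  rcases eq_or_ne s 0 with rfl | hs
  · simp
  field_simp

theorem boundB_eq {δ q : ℝ} (hq : 0 < q) (hq' : q < 1) (n : ℕ) :
    boundB δ q n = -(qShift (q ^ (δ + 1)) q 0 * qShift (q ^ (δ + 1)) q 2) /
      (qNum q n + q * qShift (q ^ (δ + 1)) q n) / (-q ^ (δ + 1) / (1 - q)) := by
  have h1 : 1 - q ≠ 0 := (sub_pos.2 hq').ne'
  have ha : 0 < q ^ (δ + 1) := Real.rpow_pos_of_pos hq _
  have e1 : q ^ (δ + 3) = q ^ (δ + 1) * q ^ 2 := by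
    rw [← rpow_add_nat hq]; push_cast; ring_nf
  have e2 : q ^ (δ + n + 1) = q ^ (δ + 1) * q ^ n := by
    rw [← rpow_add_nat hq]; ring_nf
  have e3 : qNum q n + q * qShift (q ^ (δ + 1)) q n =
      ((1 - q ^ n) + q * (1 - q ^ (δ + 1) * q ^ n)) / (1 - q) := by
    rw [qNum, qShift]; ring
  rw [boundB, e1, e2, e3]
  simp only [qShift, pow_zero, mul_one]
  generalize (1 - q ^ n) + q * (1 - q ^ (δ + 1) * q ^ n) = s
  rcases eq_or_ne s 0 with rfl | hs
  · simp
  field_simp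

theorem neg_boundC_lt_boundB {δ q : ℝ} (hq : 0 < q) (hq' : q < 1) (ha : 1 < q ^ (δ + 1))
    (haq : q ^ (δ + 1) * q < 1) (N : ℕ) :
    -boundC δ q (N + 2 - 1) < boundB δ q (N + 2) := by
  have h := admissible_q hq hq' ha haq
  have tn := h.succ_pos (N + 1)
  have νn := h.num_pos (N + 1)
  have h1 : 0 < 1 - q := sub_pos.2 hq'
  have t2 := h.succ_pos 1
  have hD : 0 < 1 - q ^ (N + 2) + q * (1 - q ^ (δ + 1) * q ^ (N + 2)) := by
    have : 0 < (1 - q) * (qNum q (N + 2) + q * qShift (q ^ (δ + 1)) q (N + 2)) := by positivity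
    refine this.trans_eq ?_
    rw [qNum, qShift]
    field_simp
  have e1 : q ^ (δ + 3) = q ^ (δ + 1) * q ^ 2 := by
    rw [← rpow_add_nat hq]; push_cast; ring_nf
  have e2 : q ^ (δ + (N + 2 : ℕ) + 1) = q ^ (δ + 1) * q ^ (N + 2) := by
    rw [← rpow_add_nat hq]; ring_nf
  have e3 : q ^ (δ + (N + 2 - 1 : ℕ) + 1) = q ^ (δ + 1) * q ^ (N + 1) := by
    rw [← rpow_add_nat hq]; congr 1; push_cast [show N + 2 - 1 = N + 1 from rfl]; ring
  rw [boundB, boundC, e1, e2, e3, neg_neg, ← sub_pos]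
  generalize q ^ (δ + 1) = a at *
  have hw : 0 < 1 - q ^ (N + 1) := sub_pos.2 (pow_lt_one₀ hq.le hq' (by omega))
  have ha' : 0 < a - 1 := sub_pos.2 ha
  -- The exact difference of the two bounds.
  have : 0 < (a - 1) * ((1 + q) * (1 - q ^ (N + 1))) /
      (a * q ^ (N + 1) * (1 - q ^ (N + 2) + q * (1 - a * q ^ (N + 2)))) := by positivity
  refine this.trans_eq ?_
  generalize hE : 1 - q ^ (N + 2) + q * (1 - a * q ^ (N + 2)) = E at *
  field_simp
  rw [← hE]
  ring

theorem tendsto_boundA {δ : ℝ} {n : ℕ} (h : δ + n + 1 ≠ 0) :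
    Tendsto (fun q => boundA δ q n / (1 - q)) (𝓝[<] 1)
      (𝓝 ((δ + 1) * (δ + 2) / (δ + n + 1))) := by
  have := ((tendsto_one_sub_rpow_div (δ + 1)).mul (tendsto_one_sub_rpow_div (δ + 2))).div
    ((tendsto_rpow_one (δ + 1)).mul (tendsto_one_sub_rpow_div (δ + n + 1))) (by simpa using h)
  rw [one_mul] at this
  refine this.congr' ?_
  filter_upwards [eventually_mem_unit] with q hq
  have h1 : 1 - q ≠ 0 := (sub_pos.2 hq.2).ne'
  simp only [boundA, Pi.div_apply]
  field_simp

theorem tendsto_boundB {δ : ℝ} {n : ℕ} (h : 2 * n + δ + 1 ≠ 0) :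
    Tendsto (fun q => boundB δ q n / (1 - q)) (𝓝[<] 1)
      (𝓝 ((δ + 1) * (δ + 3) / (2 * n + δ + 1))) := by
  have := ((tendsto_one_sub_rpow_div (δ + 1)).mul (tendsto_one_sub_rpow_div (δ + 3))).div
    ((tendsto_rpow_one (δ + 1)).mul ((tendsto_one_sub_rpow_div n).add
      (tendsto_id_one.mul (tendsto_one_sub_rpow_div (δ + n + 1)))))
    (by contrapose! h; linarith)
  rw [one_mul, one_mul, show (n : ℝ) + (δ + n + 1) = 2 * n + δ + 1 by ring] at this
  refine this.congr' ?_
  filter_upwards [eventually_mem_unit] with q hq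
  have h1 : 1 - q ≠ 0 := (sub_pos.2 hq.2).ne'
  have e : (1 - q ^ (n : ℝ)) / (1 - q) + q * ((1 - q ^ (δ + n + 1)) / (1 - q)) =
      ((1 - q ^ n) + q * (1 - q ^ (δ + n + 1))) / (1 - q) := by
    rw [Real.rpow_natCast]; ring
  simp only [boundB, Pi.div_apply, e]
  field_simp

theorem tendsto_boundC (δ : ℝ) (n : ℕ) :
    Tendsto (fun q => -boundC δ q n / (1 - q)) (𝓝[<] 1) (𝓝 (δ + 1)) := by
  have := (tendsto_one_sub_rpow_div (δ + 1)).div (tendsto_rpow_one (δ + n + 1)) one_ne_zero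
  rw [div_one] at this
  refine this.congr fun q => ?_
  rw [Pi.div_apply, boundC, neg_neg, div_right_comm]

end QLaguerre

end

/-! ### Assembly of the theorem -/

theorem theorem4p1 (n : ℕ) (hn : 2 ≤ n) (δ : ℝ) (hδ : -2 < δ) (hδ' : δ < -1) :
    ∃ z : ℝ → ℝ,
      -- for every `q`, `z q` is the negative zero, and it obeys the bounds
      (∀ q : ℝ, 0 < q → q < 1 →
        QLaguerre.IsUniqueNegZero (QLaguerre.qLaguerre δ q n) (z q) ∧
        -QLaguerre.boundC δ q (n - 1) < QLaguerre.boundB δ q n ∧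
        QLaguerre.boundB δ q n < z q ∧
        z q < QLaguerre.boundA δ q n ∧
        QLaguerre.boundA δ q n < 0) ∧
      -- the limit `q → 1`: zeros and bounds, rescaled by `1 - q`, converge to the
      -- negative zero of the Laguerre polynomial and to its bounds
      ∃ x : ℝ,
        QLaguerre.IsUniqueNegZero (QLaguerre.laguerre δ n) x ∧
        Tendsto (fun q => z q / (1 - q)) (𝓝[<] 1) (𝓝 x) ∧
        Tendsto (fun q => -QLaguerre.boundC δ q (n - 1) / (1 - q)) (𝓝[<] 1) (𝓝 (δ + 1)) ∧
        Tendsto (fun q => QLaguerre.boundB δ q n / (1 - q)) (𝓝[<] 1)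
          (𝓝 ((δ + 1) * (δ + 3) / (2 * n + δ + 1))) ∧
        Tendsto (fun q => QLaguerre.boundA δ q n / (1 - q)) (𝓝[<] 1)
          (𝓝 ((δ + 1) * (δ + 2) / (δ + n + 1))) ∧
        δ + 1 < (δ + 1) * (δ + 3) / (2 * n + δ + 1) ∧
        (δ + 1) * (δ + 3) / (2 * n + δ + 1) < x ∧
        x < (δ + 1) * (δ + 2) / (δ + n + 1) ∧
        (δ + 1) * (δ + 2) / (δ + n + 1) < 0 := by
  open QLaguerre in
  obtain ⟨N, rfl⟩ := Nat.exists_eq_add_of_le' hn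
  have ha : ∀ q : ℝ, 0 < q → q < 1 → 1 < q ^ (δ + 1) ∧ q ^ (δ + 1) * q < 1 := fun q hq hq' => by
    refine ⟨Real.one_lt_rpow_of_pos_of_lt_one_of_neg hq hq' (by linarith), ?_⟩
    rw [← Real.rpow_add_one hq.ne']
    exact Real.rpow_lt_one hq.le hq' (by linarith)
  have hy : ∀ q : ℝ, 0 < q ∧ q < 1 → _ := fun q hq =>
    exists_root_q hq.1 hq.2 (ha q hq.1 hq.2).1 (ha q hq.1 hq.2).2 N
  choose! y hy using hy
  obtain ⟨x, hx, hx0, hxA, hxB⟩ := exists_root_classical hδ hδ' N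
  have hC := admissible_classical hδ hδ'
  have hN : (0 : ℝ) ≤ N := N.cast_nonneg
  have hDA : 0 < δ + (N + 2 : ℕ) + 1 := by push_cast; linarith
  have hDB : 0 < 2 * ((N + 2 : ℕ) : ℝ) + δ + 1 := by push_cast; linarith
  -- For b ≥ 0 with b ≠ x the limit polynomial is nonzero at b, so for q near 1 the q-polynomial has
  -- the same sign there; monotonicity then places b on the correct side of `y q`.
  have hlim : Tendsto y (𝓝[<] 1) (𝓝 x) := by
    refine tendsto_order.2 ⟨fun b hb => ?_, fun b hb => ?_⟩
    · rcases lt_or_ge b 0 with hb0 | hb0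
      · filter_upwards [eventually_mem_unit] with q hq using hb0.trans (hy q hq).1
      · have hneg := hC.strictMonoOn_eval (Nat.succ_ne_zero (N + 1)) hb0 hx.le hb
        simp only [hx0] at hneg
        filter_upwards [eventually_mem_unit,
          (tendsto_eval_genPoly δ (N + 2) b).eventually_lt_const hneg] with q hq hqb
        have hQ := admissible_q hq.1 hq.2 (ha q hq.1 hq.2).1 (ha q hq.1 hq.2).2
        refine ((hQ.strictMonoOn_eval (Nat.succ_ne_zero (N + 1))).lt_iff_lt hb0 (hy q hq).1.le).1 ?_
        simpa only [(hy q hq).2.1] using hqb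
    · have hpos := hC.strictMonoOn_eval (Nat.succ_ne_zero (N + 1)) hx.le (hx.trans hb).le hb
      simp only [hx0] at hpos
      filter_upwards [eventually_mem_unit,
        (tendsto_eval_genPoly δ (N + 2) b).eventually_const_lt hpos] with q hq hqb
      have hQ := admissible_q hq.1 hq.2 (ha q hq.1 hq.2).1 (ha q hq.1 hq.2).2
      refine ((hQ.strictMonoOn_eval (Nat.succ_ne_zero (N + 1))).lt_iff_lt (hy q hq).1.le
        (hx.trans hb).le).1 ?_
      simpa only [(hy q hq).2.1] using hqb
  refine ⟨fun q => y q / (-q ^ (δ + 1) / (1 - q)), fun q hq hq' => ?_, -x, ?_, ?_,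
    tendsto_boundC δ _, tendsto_boundB hDB.ne', tendsto_boundA hDA.ne', ?_, ?_, ?_, ?_⟩
  · obtain ⟨h0, hr, hA, hB⟩ := hy q ⟨hq, hq'⟩
    have hQ := admissible_q hq hq' (ha q hq hq').1 (ha q hq hq').2
    have hapos : 0 < q ^ (δ + 1) := Real.rpow_pos_of_pos hq _
    have hneg : -q ^ (δ + 1) / (1 - q) < 0 :=
      div_neg_of_neg_of_pos (by linarith) (sub_pos.2 hq')
    refine ⟨?_, neg_boundC_lt_boundB hq hq' (ha q hq hq').1 (ha q hq hq').2 N, ?_, ?_, ?_⟩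
    · rw [qLaguerre_eq hq hq']
      exact hQ.isUniqueNegZero (Nat.succ_ne_zero (N + 1)) h0 hr
        (qScale_ne_zero hapos hq hq' _) hneg
    · rw [boundB_eq hq hq']
      exact div_lt_div_of_neg_of_lt hneg hB
    · rw [boundA_eq hq hq']
      exact div_lt_div_of_neg_of_lt hneg hA
    · rw [boundA_eq hq hq']
      have h1 : 0 < qShift (q ^ (δ + 1)) q 1 := hQ.succ_pos 0
      exact div_neg_of_pos_of_neg (div_pos (by nlinarith [hQ.zero_neg]) (hQ.succ_pos (N + 1))) hneg
  · rw [laguerre_eq]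
    have := hC.isUniqueNegZero (Nat.succ_ne_zero (N + 1)) hx hx0
      (c := 1 / ((N + 2).factorial : ℝ)) (by positivity) neg_one_lt_zero
    rwa [div_neg, div_one] at this
  -- Here z/(1-q) = -y/q^(δ+1), with denominator tending to 1.
  · have := (hlim.div (tendsto_rpow_one (δ + 1)) one_ne_zero).neg
    rw [div_one] at this
    refine this.congr' ?_
    filter_upwards [eventually_mem_unit] with q hq
    have h1 : 1 - q ≠ 0 := (sub_pos.2 hq.2).ne'
    have hapos : 0 < q ^ (δ + 1) := Real.rpow_pos_of_pos hq.1 _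
    rw [Pi.div_apply]
    field_simp
  · rw [lt_div_iff₀ hDB]
    push_cast
    nlinarith
  · rw [lt_neg, ← neg_div]
    exact hxB
  · rw [neg_lt, ← neg_div]
    exact hxA
  · exact div_neg_of_neg_of_pos (by nlinarith) hDA
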